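/- A mean-payoff poorman game $\mathcal G=\langle V,E,w\rangle$ consists of a finite directed graph $(V,E)$ and weights $w:V\to\mathbb R$. A token is moved along the edges by two players, Max and Min, with initial budgets $B_{\max},B_{\min}\ge 0$, $B_{\max}+B_{\min}>0$. In each round both players simultaneously choose a bid that is nonnegative and does not exceed their available budget, and a neighbor of the current vertex; the higher bidder pays his bid to the bank and moves the token to the neighbor that he chose, and ties are resolved by some fixed mechanism. Strategies depend on the history (vertices visited, winning bids, winners). The energy of the prefix $\pi^n=v_1,\dots,v_n$ of the resulting path $\pi$ is $E(\pi^n)=\sum_{1\le j<n}w(v_j)$, and Max's payoff (Min's cost) is $\liminf_{n\to\infty}E(\pi^n)/n$. Max's initial ratio is $B_{\max}/(B_{\max}+B_{\min})$. A number $c$ is the value of $\mathcal G$ from $v$ with respect to $r\in[0,1]$ if for every $\epsilon>0$: (1) when Max's initial ratio is $\min(r+\epsilon,1)$, Max has a strategy that guarantees a payoff of at least $c$ from $v$ against every strategy of Min, and (2) when Max's initial ratio is $\max(r-\epsilon,0)$, Min has a strategy that guarantees a payoff of at most $c$ from $v$ against every strategy of Max. The random-turn game $\mathrm{RT}^r(\mathcal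 G)$ is the stochastic game with vertices $v_N,v_{\max},v_{\min}$ of weight $w(v)$ for $v\in V$, where from $v_N$ nature moves to $v_{\max}$ with probability $r$ and to $v_{\min}$ with probability $1-r$, and from $v_{\max}$ (resp. $v_{\min}$) Max (resp. Min) moves to $u_N$ for a neighbor $u$ of $v$ of his choice. Its mean-payoff value $\mathrm{MP}(\mathrm{RT}^r(\mathcal G))$ is $\sup_f\inf_g$ of the expected payoff over strategies $f$ of Max and $g$ of Min. Theorem. Let $\mathcal G$ be a strongly-connected mean-payoff poorman game (every vertex is reachable from every vertex by a path with at least one edge), with any tie-breaking mechanism, and let $r\in[0,1]$. Then $\mathcal G$ has a unique value with respect to $r$, it does not depend on the initial vertex, and it equals $c=\mathrm{MP}(\mathrm{RT}^r(\mathcal G))$, which does not depend on the initial vertex $u_N$, $u\in V$, either. Moreover, for every $\epsilon>0$, initial vertex and initial budgets: if Max's initial ratio is $\min(r+\epsilon,1)$, then there are a constant $K$ and a strategy of Max that guarantees $E(\pi^n)\ge c\,n-K$ for all $n$ against every strategy of Min; and if Max's initial ratio is $\max(r-\epsilon,0)$, then there are a constant $K$ and a strategy of Min that guarantees $E(\pi^n)\le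 c\,n+K$ for all $n$ against every strategy of Max. -/

import Mathlib

open MeasureTheory ProbabilityTheory

noncomputable section

namespace Poorman

/-! ### Weighted graphs, energy and payoff -/

/-- A mean-payoff game arena: a directed graph on `V` with weighted vertices. -/
structure MeanPayoffGame (V : Type*) where
  edge : V → V → Prop
  weight : V → ℝ

/-- Every vertex can be reached from every vertex by a path with at least one edge. (In a one-point
graph this asks for the self-loop, without which there is no infinite path.) -/
def MeanPayoffGame.StronglyConnected {V : Type*} (G : MeanPayoffGame V) : Prop :=
  ∀ u v : V, Relation.TransGen G.edge u v

/-- The energy of the prefix `π 0, …, π (n - 1)` of length `n` of an infinite sequence `π`: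
the sum of the weights of its vertices except for the last one. -/
def energy {S : Type*} (w : S → ℝ) (π : ℕ → S) (n : ℕ) : ℝ :=
  ∑ i ∈ Finset.range (n - 1), w (π i)

/-- The mean payoff `liminf (1 / n) E(πⁿ)`. For weights on a finite set the averages are
bounded. -/
def payoff {S : Type*} (w : S → ℝ) (π : ℕ → S) : ℝ :=
  Filter.liminf (fun n : ℕ => energy w π n / n) Filter.atTop

/-! ### Bidding games under poorman rules -/

inductive Player
  | max
  | min

/-- A history: an initial vertex, followed by rounds, each of which records the vertex to which
the token was moved, the winning bid, and the winner of the bidding. -/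
inductive History (V : Type*)
  | start (v : V) : History V
  | round (h : History V) (dest : V) (bid : ℝ) (winner : Player) : History V

/-- The current position of the token. -/
def History.pos {V : Type*} : History V → V
  | .start v => v
  | .round _ u _ _ => u

/-- The sum of the winning bids of a player, which he has paid to the bank. -/
def History.spent {V : Type*} : History V → Player → ℝ
  | .start _, _ => 0
  | .round h _ b .max, .max => h.spent .max + b
  | .round h _ b .min, .min => h.spent .min + b
  | .round h _ _ .max, .min => h.spent .min
  | .round h _ _ .min, .max => h.spent .max

/-- A bid, and the vertex to move the token to upon winning the bidding. -/
structure Action (V : Type*) where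
  bid : ℝ
  dest : V

/-- A bidding strategy. -/
abbrev BidStrategy (V : Type*) := History V → Action V

/-- A mechanism that resolves ties: given the history and the actions of Max and of Min, it
names the winner of a bidding in which both bids are equal. -/
abbrev TieBreak (V : Type*) := History V → Action V → Action V → Player

/-- `f` is a strategy for player `p` with initial budget `B`: it moves along edges, and its bids
are nonnegative and do not exceed the available budget. (Nothing is asked of the bids after a
history in which `p` has paid more than `B`, which no play visits.) -/
def MeanPayoffGame.Legal {V : Type*} (G : MeanPayoffGame V) (p : Player) (B : ℝ)
    (f : BidStrategy V) : Prop :=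
  ∀ h : History V, G.edge h.pos (f h).dest ∧
    (h.spent p ≤ B → 0 ≤ (f h).bid ∧ (f h).bid ≤ B - h.spent p)

open Classical in
/-- The winner of the bidding in which Max plays the action `a` and Min plays the action `b`. -/
def bidWinner {V : Type*} (tie : TieBreak V) (h : History V) (a b : Action V) : Player :=
  if b.bid < a.bid then .max else if a.bid < b.bid then .min else tie h a b

/-- One round of the game: the winner pays his bid and moves the token. -/
def nextHistory {V : Type*} (tie : TieBreak V) (f g : BidStrategy V) (h : History V) : History V :=
  match bidWinner tie h (f h) (g h) with
  | .max => .round h (f h).dest (f h).bid .max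
  | .min => .round h (g h).dest (g h).bid .min

/-- The play from `v` in which Max uses `f` and Min uses `g`: its history after `n` rounds. -/
def play {V : Type*} (tie : TieBreak V) (v : V) (f g : BidStrategy V) : ℕ → History V
  | 0 => .start v
  | n + 1 => nextHistory tie f g (play tie v f g n)

/-- The infinite path of vertices that a play visits. -/
def path {V : Type*} (tie : TieBreak V) (v : V) (f g : BidStrategy V) (n : ℕ) : V :=
  (play tie v f g n).pos

/-- From `v` and with budgets `Bmax` and `Bmin`, Max has a strategy that ensures, against every
strategy of Min, that the path satisfies `O`. -/
def MeanPayoffGame.MaxEnsures {V : Type*} (G : MeanPayoffGame V) (tie : TieBreak V) (v : V)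
    (Bmax Bmin : ℝ) (O : (ℕ → V) → Prop) : Prop :=
  ∃ f : BidStrategy V, G.Legal .max Bmax f ∧
    ∀ g : BidStrategy V, G.Legal .min Bmin g → O (path tie v f g)

/-- The same for Min. -/
def MeanPayoffGame.MinEnsures {V : Type*} (G : MeanPayoffGame V) (tie : TieBreak V) (v : V)
    (Bmax Bmin : ℝ) (O : (ℕ → V) → Prop) : Prop :=
  ∃ g : BidStrategy V, G.Legal .min Bmin g ∧
    ∀ f : BidStrategy V, G.Legal .max Bmax f → O (path tie v f g)

/-- `Bmax` and `Bmin` are initial budgets for which the initial ratio of Max is `ρ`. -/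
def InitialRatio (Bmax Bmin ρ : ℝ) : Prop :=
  0 ≤ Bmax ∧ 0 ≤ Bmin ∧ 0 < Bmax + Bmin ∧ Bmax / (Bmax + Bmin) = ρ

/-- `c` is the value, from the vertex `v`, with respect to the ratio `r`: for every `ε > 0`, Max
guarantees a payoff of at least `c` when his initial ratio is `r + ε`, and Min guarantees a payoff
of at most `c` when the initial ratio of Max is `r - ε`. Ratios are truncated to `[0, 1]`; without
this the second part would be vacuous for `r = 0`, and the first one for `r = 1`. -/
def MeanPayoffGame.IsValue {V : Type*} (G : MeanPayoffGame V) (tie : TieBreak V) (v : V)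
    (r c : ℝ) : Prop :=
  ∀ ε : ℝ, 0 < ε → ∀ Bmax Bmin : ℝ,
    (InitialRatio Bmax Bmin (min (r + ε) 1) →
      G.MaxEnsures tie v Bmax Bmin fun π => c ≤ payoff G.weight π) ∧
    (InitialRatio Bmax Bmin (max (r - ε) 0) →
      G.MinEnsures tie v Bmax Bmin fun π => payoff G.weight π ≤ c)

/-! ### Stochastic games -/

inductive Owner
  | max
  | min
  | nature

/-- A stochastic game with weighted vertices, each of which is controlled by Max, by Min or by
nature. -/
structure StochasticGame (S : Type*) [MeasurableSpace S] where
  owner : S → Owner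
  /-- The moves available to the players at their vertices. -/
  edge : S → S → Prop
  /-- The distribution of the next vertex at a vertex of nature. -/
  prob : ∀ s, owner s = .nature → Measure S
  isProb : ∀ s hs, IsProbabilityMeasure (prob s hs)
  weight : S → ℝ

namespace StochasticGame

variable {S : Type*} [MeasurableSpace S]

/-- The last vertex of a finite sequence `x 0, …, x n`. -/
def last {n : ℕ} (x : Finset.Iic n → S) : S := x ⟨n, Finset.mem_Iic.2 le_rfl⟩

/-- A strategy for `o`: after visiting `x 0, …, x n` it chooses the next vertex, which has to be
a neighbor of the current one when this is controlled by `o`. -/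
def Strategy (G : StochasticGame S) (o : Owner) : Type _ :=
  {f : (n : ℕ) → (Finset.Iic n → S) → S //
    ∀ n x, G.owner (last x) = o → G.edge (last x) (f n x)}

/-- The distribution of the next vertex after visiting `x 0, …, x n`. -/
def step (G : StochasticGame S) (f : G.Strategy .max) (g : G.Strategy .min) (n : ℕ)
    (x : Finset.Iic n → S) : Measure S :=
  match ho : G.owner (last x) with
  | .max => Measure.dirac (f.1 n x)
  | .min => Measure.dirac (g.1 n x)
  | .nature => G.prob (last x) ho

theorem isProbabilityMeasure_step (G : StochasticGame S) (f : G.Strategy .max)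
    (g : G.Strategy .min) (n : ℕ) (x : Finset.Iic n → S) :
    IsProbabilityMeasure (G.step f g n x) := by
  unfold step
  split
  · infer_instance
  · infer_instance
  · exact G.isProb _ _

variable [Finite S] [DiscreteMeasurableSpace S]

/-- The distribution of the next vertex, as a kernel. -/
def kernel (G : StochasticGame S) (f : G.Strategy .max) (g : G.Strategy .min) (n : ℕ) :
    Kernel (Finset.Iic n → S) S :=
  Kernel.ofFunOfCountable (G.step f g n)

instance (G : StochasticGame S) (f : G.Strategy .max) (g : G.Strategy .min) (n : ℕ) :
    IsMarkovKernel (G.kernel f g n) :=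
  ⟨fun x => G.isProbabilityMeasure_step f g n x⟩

/-- The probability distribution over infinite sequences of vertices that start in `s` and
continue according to `f` and `g`. -/
def law (G : StochasticGame S) (f : G.Strategy .max) (g : G.Strategy .min) (s : S) :
    Measure (ℕ → S) :=
  Kernel.traj (X := fun _ => S) (G.kernel f g) 0 fun _ => s

/-- The mean-payoff value from `s`: the largest expected payoff that Max can guarantee. -/
def value (G : StochasticGame S) (s : S) : ℝ :=
  ⨆ f : G.Strategy .max, ⨅ g : G.Strategy .min, ∫ π, payoff G.weight π ∂(G.law f g s)

end StochasticGame

/-! ### Random-turn games -/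

/-- The vertices of a random-turn game: three copies of each vertex `v`, in one of which nature
selects a player, and in the other two of which the selected player moves. -/
inductive RTVertex (V : Type*)
  | maxTurn (v : V) : RTVertex V
  | minTurn (v : V) : RTVertex V
  | nature (v : V) : RTVertex V

namespace RTVertex

variable {V : Type*}

/-- The vertex of the original graph. -/
def base : RTVertex V → V
  | maxTurn v => v
  | minTurn v => v
  | nature v => v

/-- Who controls the vertex. -/
def owner : RTVertex V → Owner
  | maxTurn _ => .max
  | minTurn _ => .min
  | nature _ => .nature

instance : MeasurableSpace (RTVertex V) := ⊤

instance : DiscreteMeasurableSpace (RTVertex V) := ⟨fun _ => trivial⟩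

instance [Finite V] : Finite (RTVertex V) :=
  Finite.of_surjective
    (fun x : V ⊕ V ⊕ V => x.elim maxTurn fun y => y.elim minTurn nature) fun s =>
      match s with
      | maxTurn v => ⟨.inl v, rfl⟩
      | minTurn v => ⟨.inr (.inl v), rfl⟩
      | nature v => ⟨.inr (.inr v), rfl⟩

end RTVertex

/-- The random-turn game `RTʳ(G)`: at the nature copy of a vertex, Max is selected with
probability `r` and Min with probability `1 - r`; the selected player then moves to the nature
copy of a neighbor. -/
def MeanPayoffGame.randomTurn {V : Type*} (G : MeanPayoffGame V) (r : unitInterval) :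
    StochasticGame (RTVertex V) where
  owner := RTVertex.owner
  edge s t := ∃ u, t = .nature u ∧ G.edge s.base u
  prob s _ := bernoulliMeasure (RTVertex.maxTurn s.base) (RTVertex.minTurn s.base) r
  isProb _ _ := inferInstance
  weight s := G.weight s.base

end Poorman

end

noncomputable section

namespace Poorman

/-! ### Plays -/

/-! Everything rests on the optimality equation `h v + c = w v + r h (up v) + (1 - r) h (down v)`,
where `up v` and `down v` are the best and worst neighbors of `v` for `h` (`IsPotential`). Put `s v
= h (up v) - h (down v)`. Relative to the drift `c` and corrected by `h`, the energy then rises by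
`(1 - r) s v` when Max moves to `up v`, and falls by at most `r s v` when Min moves.

A player whose share exceeds his threshold (`r` for Max, `1 - r` for Min) keeps the corrected energy
bounded on his side. He maintains a positive credit `x`, a constant plus his accumulated gain, with
`k C ≤ x ((1 - r) B - r C)`, where `B` and `C` are the remaining budgets and Min uses `1 - r` for
`r`. `BudgetInvariant.exists_bid` finds a bid after which this survives both winning and losing.
Since `h` is bounded, this gives the energy bounds and hence the payoff bounds; ties are harmless
because losing one is covered by the losing case.

A solution exists by the vanishing-discount method: strong connectivity bounds the oscillation of
the discounted solutions, and compactness gives a limit (`exists_bellman_eq`). The same potential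
makes `c` the value of the random-turn game: its drift has a sign under the positional strategies
`up` and `down`, and an exponential-moment estimate turns this into almost sure payoff bounds
(`ae_eventually_nonneg`).

For uniqueness, `c` is Lipschitz in `r`, so a strategy guaranteeing another value at `r` can be
played against an optimal one for a nearby ratio (`IsPotential.value_le`, `IsPotential.le_value`).
-/

theorem History.spent_round_self {V : Type*} (h : History V) (u : V) (b : ℝ) (p : Player) :
    (History.round h u b p).spent p = h.spent p + b := by
  cases p <;> rfl

theorem History.spent_round_of_ne {V : Type*} (h : History V) (u : V) (b : ℝ) {p q : Player}
    (hpq : p ≠ q) : (History.round h u b p).spent q = h.spent q := by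
  cases p <;> cases q <;> first | rfl | exact absurd rfl hpq

section Plays

variable {V : Type*} {G : MeanPayoffGame V}

/-- Since `hlose` allows equal bids, every tie may be counted as lost and the mechanism disappears.
`hC` is needed because legality constrains the opponent's bid only while he has not overspent. -/
theorem play_induction_max (tie : TieBreak V) {v : V} {f g : BidStrategy V} {C : ℝ}
    {Q : History V → Prop} (h₀ : Q (.start v)) (hC : ∀ h, Q h → h.spent .min ≤ C)
    (hwin : ∀ h, Q h → Q (.round h (f h).dest (f h).bid .max))
    (hlose : ∀ h u b, Q h → G.edge h.pos u → (f h).bid ≤ b → b ≤ C - h.spent .min →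
      Q (.round h u b .min))
    (hg : G.Legal .min C g) (n : ℕ) : Q (play tie v f g n) := by
  induction n with
  | zero => exact h₀
  | succ n ih =>
    have hl := hg (play tie v f g n)
    have key : (f (play tie v f g n)).bid ≤ (g (play tie v f g n)).bid →
        Q (.round (play tie v f g n) (g (play tie v f g n)).dest (g (play tie v f g n)).bid .min) :=
      fun hb => hlose _ _ _ ih hl.1 hb (hl.2 (hC _ ih)).2
    simp only [play, nextHistory, bidWinner]
    split
    · exact hwin _ ih
    · rename_i heq
      refine key (not_lt.1 fun hlt => ?_)
      rw [if_pos hlt] at heq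
      cases heq

theorem play_induction_min (tie : TieBreak V) {v : V} {f g : BidStrategy V} {C : ℝ}
    {Q : History V → Prop} (h₀ : Q (.start v)) (hC : ∀ h, Q h → h.spent .max ≤ C)
    (hwin : ∀ h, Q h → Q (.round h (g h).dest (g h).bid .min))
    (hlose : ∀ h u b, Q h → G.edge h.pos u → (g h).bid ≤ b → b ≤ C - h.spent .max →
      Q (.round h u b .max))
    (hf : G.Legal .max C f) (n : ℕ) : Q (play tie v f g n) := by
  induction n with
  | zero => exact h₀
  | succ n ih =>
    have hl := hf (play tie v f g n)
    have key : (g (play tie v f g n)).bid ≤ (f (play tie v f g n)).bid →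
        Q (.round (play tie v f g n) (f (play tie v f g n)).dest (f (play tie v f g n)).bid .max) :=
      fun hb => hlose _ _ _ ih hl.1 hb (hl.2 (hC _ ih)).2
    simp only [play, nextHistory, bidWinner]
    split
    · rename_i heq
      refine key (not_lt.1 fun hlt => ?_)
      rw [if_neg (not_lt.2 hlt.le), if_pos hlt] at heq
      cases heq
    · exact hwin _ ih

theorem edge_path (tie : TieBreak V) (v : V) {f g : BidStrategy V} {B C : ℝ}
    (hf : G.Legal .max B f) (hg : G.Legal .min C g) (n : ℕ) :
    G.edge (path tie v f g n) (path tie v f g (n + 1)) := by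
  simp only [path, play, nextHistory]
  split
  · exact (hf _).1
  · exact (hg _).1

theorem exists_legal (hG : ∀ v, ∃ u, G.edge v u) (p : Player) {B : ℝ} :
    ∃ f, G.Legal p B f := by
  choose next hnext using hG
  exact ⟨fun h => ⟨0, next h.pos⟩, fun h => ⟨hnext _, fun hB => ⟨le_rfl, sub_nonneg.2 hB⟩⟩⟩

/-! ### The budget invariant -/

/-- The invariant of a player with budget `B` against an opponent with budget `C`: the credit `x`
outweighs the opponent's budget, relative to the advantage `(1 - r) B - r C`. -/
structure BudgetInvariant (k r B C x : ℝ) : Prop where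
  own_pos : 0 < B
  opponent_nonneg : 0 ≤ C
  credit_pos : 0 < x
  le_mul : k * C ≤ x * ((1 - r) * B - r * C)

theorem BudgetInvariant.mono {k r B C x y : ℝ} (h : BudgetInvariant k r B C x) (hk : 0 ≤ k)
    (hxy : x ≤ y) : BudgetInvariant k r B C y := by
  obtain ⟨hB, hC, hx, hle⟩ := h
  have hD : 0 ≤ (1 - r) * B - r * C := by
    have : 0 ≤ x * ((1 - r) * B - r * C) := (mul_nonneg hk hC).trans hle
    exact nonneg_of_mul_nonneg_right this hx
  exact ⟨hB, hC, hx.trans_le hxy, hle.trans (mul_le_mul_of_nonneg_right hxy hD)⟩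

/-- The bid is chosen so that winning preserves equality in the invariant; the surplus `k - r s`
then makes losing safe as well. -/
theorem BudgetInvariant.exists_bid {k r B C x s : ℝ} (h : BudgetInvariant k r B C x) (hr₀ : 0 ≤ r)
    (hr₁ : r ≤ 1) (hs : 0 ≤ s) (hk₀ : 0 < k) (hk : r * s < k) :
    ∃ b, 0 ≤ b ∧ b ≤ B ∧ BudgetInvariant k r (B - b) C (x + (1 - r) * s) ∧
      ∀ b', b ≤ b' → b' ≤ C → BudgetInvariant k r B (C - b') (x - r * s) := by
  obtain ⟨hB, hC, hx, hle⟩ := h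
  have hr₁' : 0 ≤ 1 - r := by linarith
  have hxs : 0 < x + (1 - r) * s := by positivity
  -- Against an empty budget any positive bid wins, and half of `B` leaves a positive budget. The
  -- advantage may vanish here, as for `r = 1`.
  obtain rfl | hCpos := hC.eq_or_lt
  · refine ⟨B / 2, by linarith, by linarith, ⟨by linarith, le_rfl, hxs, ?_⟩, ?_⟩
    · have : 0 ≤ (x + (1 - r) * s) * ((1 - r) * (B - B / 2)) := by
        have : 0 ≤ B - B / 2 := by linarith
        positivity
      linarith
    · intro b' h₁ h₂
      linarith
  -- This `b` solves `(1 - r) b = (1 - r) k C s / (x (x + (1 - r) s))`, the drop from `k C / x` to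
  -- `k C / (x + (1 - r) s)` in the advantage that is required.
  · obtain ⟨b, hb₀, hbx⟩ : ∃ b, 0 ≤ b ∧ b * (x * (x + (1 - r) * s)) = k * C * s :=
      ⟨k * C * s / (x * (x + (1 - r) * s)), by positivity, div_mul_cancel₀ _ (by positivity)⟩
    have hwin : k * C ≤ (x + (1 - r) * s) * ((1 - r) * (B - b) - r * C) := by
      have h₁ : x * (k * C) ≤
          x * ((x + (1 - r) * s) * ((1 - r) * (B - b) - r * C)) := by
        have := mul_le_mul_of_nonneg_right hle hxs.le
        linear_combination this + (1 - r) * hbx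
      exact le_of_mul_le_mul_left h₁ hx
    have hBb : 0 < B - b := by
      have h₁ : 0 < (1 - r) * (B - b) - r * C :=
        pos_of_mul_pos_right ((mul_pos hk₀ hCpos).trans_le hwin) hxs.le
      have h₂ : 0 < (1 - r) * (B - b) := by nlinarith [mul_nonneg hr₀ hC]
      exact pos_of_mul_pos_right h₂ hr₁'
    refine ⟨b, hb₀, by linarith, ⟨hBb, hC, hxs, hwin⟩, fun b' hbb' hb'C => ?_⟩
    -- If the credit could not pay for a loss, then `b` would exceed `C`, and the opponent could not
    -- have won.
    have hxr : 0 < x - r * s := by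
      by_contra! hcon
      have hspos : 0 < s := by
        rcases hs.eq_or_lt with rfl | h
        · linarith
        · exact h
      have h₁ : x * (x + (1 - r) * s) ≤ r * s * s := by
        have : x + (1 - r) * s ≤ s := by linarith
        exact mul_le_mul (by linarith) this hxs.le (by positivity)
      have h₂ : b * (x * (x + (1 - r) * s)) ≤ C * (r * s * s) :=
        mul_le_mul (hbb'.trans hb'C) h₁ (by positivity) hC
      have h₃ : C * s * (k - r * s) ≤ 0 := by linarith
      have h₄ : 0 < C * s * (k - r * s) := mul_pos (by positivity) (by linarith)
      linarith
    have hlose : k * (C - b) ≤ (x - r * s) * ((1 - r) * B - r * (C - b)) := by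
      have h₁ : x * (x + (1 - r) * s) * (k * (C - b)) ≤
          x * (x + (1 - r) * s) * ((x - r * s) * ((1 - r) * B - r * (C - b))) := by
        have h₂ := mul_le_mul_of_nonneg_right hle (mul_nonneg hxs.le hxr.le)
        have h₃ : 0 ≤ k * C * s * (k - r * s) := by
          have : 0 ≤ k - r * s := by linarith
          positivity
        linear_combination h₂ + h₃ - (k + r * (x - r * s)) * hbx
      exact le_of_mul_le_mul_left h₁ (by positivity)
    refine ⟨hB, by linarith, hxr, ?_⟩
    -- Overpayment by the opponent only loosens the invariant, so the case `b' = b` suffices.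
    have h₁ : 0 ≤ (k + (x - r * s) * r) * (b' - b) :=
      mul_nonneg (by positivity) (by linarith)
    linear_combination hlose + h₁

/-! ### Strategies that keep the potential bounded -/

/-- The accumulated gain of a history, where moving from `v` to `u` gains `a v + φ u - φ v`. -/
def History.level (a φ : V → ℝ) : History V → ℝ
  | .start _ => 0
  | .round h u _ _ => h.level a φ + (a h.pos + φ u - φ h.pos)

theorem level_play (a φ : V → ℝ) (tie : TieBreak V) (v : V) (f g : BidStrategy V) (n : ℕ) :
    (play tie v f g n).level a φ =
      ∑ i ∈ Finset.range n, a (path tie v f g i) + φ (path tie v f g n) - φ v := by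
  induction n with
  | zero => simp [path, play, History.level, History.pos]
  | succ n ih =>
    rw [Finset.sum_range_succ]
    simp only [path, play, nextHistory] at ih ⊢
    split <;> simp only [History.level, History.pos, ih] <;> ring

/-- If winning a bidding at `v` can be made to gain `(1 - r) s v`, and losing it costs at most
`r s v`, then a player whose share of the budgets exceeds `r` keeps the level bounded below. -/
theorem exists_strategy_level_ge [Finite V] {p q : Player} (hpq : p ≠ q) {a φ s : V → ℝ}
    {up : V → V} {r B C : ℝ} (v : V) (hup : ∀ v, G.edge v (up v)) (hr₀ : 0 ≤ r) (hr₁ : r ≤ 1)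
    (hs : ∀ v, 0 ≤ s v) (hgain : ∀ v, (1 - r) * s v ≤ a v + φ (up v) - φ v)
    (hloss : ∀ v u, G.edge v u → -(r * s v) ≤ a v + φ u - φ v)
    (hB : 0 < B) (hC : 0 ≤ C) (hBC : C = 0 ∨ 0 < (1 - r) * B - r * C) :
    ∃ (f : BidStrategy V) (Q : History V → Prop) (x₀ : ℝ), G.Legal p B f ∧ Q (.start v) ∧
      (∀ h, Q h → h.spent q ≤ C) ∧ (∀ h, Q h → Q (.round h (f h).dest (f h).bid p)) ∧
      (∀ h u b, Q h → G.edge h.pos u → (f h).bid ≤ b → b ≤ C - h.spent q →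
        Q (.round h u b q)) ∧
      ∀ h, Q h → -x₀ ≤ h.level a φ := by
  classical
  obtain ⟨S, hS⟩ := (Set.finite_range fun v => r * s v).bddAbove
  obtain ⟨k, hk₀, hk⟩ : ∃ k, 0 < k ∧ ∀ v, r * s v < k :=
    ⟨|S| + 1, by positivity, fun v =>
      ((hS ⟨v, rfl⟩ : r * s v ≤ S).trans (le_abs_self S)).trans_lt (lt_add_one _)⟩
  obtain ⟨x₀, hx₀⟩ : ∃ x₀, BudgetInvariant k r B C x₀ := by
    rcases hBC with rfl | hD
    · exact ⟨1, hB, le_rfl, one_pos, by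
        have : 0 ≤ (1 - r) * B := mul_nonneg (by linarith) hB.le
        linarith⟩
    -- The quotient makes the invariant tight; the `+ 1` keeps the credit positive even for `C = 0`.
    · refine ⟨k * C / ((1 - r) * B - r * C) + 1, hB, hC, by positivity, ?_⟩
      rw [add_mul, div_mul_cancel₀ _ hD.ne']
      linarith
  set Q : History V → Prop := fun h =>
    BudgetInvariant k r (B - h.spent p) (C - h.spent q) (x₀ + h.level a φ) with hQ
  have hbid : ∀ h : History V, ∃ b, (h.spent p ≤ B → 0 ≤ b ∧ b ≤ B - h.spent p) ∧
      (Q h → BudgetInvariant k r (B - h.spent p - b) (C - h.spent q)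
          (x₀ + h.level a φ + (1 - r) * s h.pos) ∧
        ∀ b', b ≤ b' → b' ≤ C - h.spent q → BudgetInvariant k r (B - h.spent p)
          (C - h.spent q - b') (x₀ + h.level a φ - r * s h.pos)) := by
    intro h
    by_cases hq : Q h
    · obtain ⟨b, h₁, h₂, h₃, h₄⟩ := hq.exists_bid hr₀ hr₁ (hs h.pos) hk₀ (hk h.pos)
      exact ⟨b, fun _ => ⟨h₁, h₂⟩, fun _ => ⟨h₃, h₄⟩⟩
    -- Off the invariant a bid of zero keeps the strategy legal.
    · exact ⟨0, fun hB => ⟨le_rfl, sub_nonneg.2 hB⟩, fun hq' => absurd hq' hq⟩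
  choose bid hbid₁ hbid₂ using hbid
  refine ⟨fun h => ⟨bid h, up h.pos⟩, Q, x₀, fun h => ⟨hup _, hbid₁ h⟩, ?_, ?_, ?_, ?_, ?_⟩
  · simpa [hQ, History.spent, History.level] using hx₀
  · intro h hq
    linarith [hq.opponent_nonneg]
  · intro h hq
    simp only [hQ, History.spent_round_self, History.spent_round_of_ne _ _ _ hpq, History.level]
    rw [← sub_sub]
    exact (hbid₂ h hq).1.mono hk₀.le (by linarith [hgain h.pos])
  · intro h u b hq hu h₁ h₂
    simp only [hQ, History.spent_round_self, History.spent_round_of_ne _ _ _ hpq.symm,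
      History.level]
    rw [← sub_sub C]
    exact ((hbid₂ h hq).2 b h₁ h₂).mono hk₀.le (by linarith [hloss h.pos u hu])
  · intro h hq
    linarith [hq.credit_pos]

end Plays

/-! ### The optimality equation and its dependence on the ratio -/

namespace MeanPayoffGame

variable {V : Type*}

/-- The optimality equation of the random-turn game: `h` is a potential for the value `c`. -/
structure IsPotential (G : MeanPayoffGame V) (r c : ℝ) (h : V → ℝ) (up down : V → V) : Prop where
  edge_up : ∀ v, G.edge v (up v)
  edge_down : ∀ v, G.edge v (down v)
  le_up : ∀ v u, G.edge v u → h u ≤ h (up v)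
  down_le : ∀ v u, G.edge v u → h (down v) ≤ h u
  eq : ∀ v, h v + c = G.weight v + r * h (up v) + (1 - r) * h (down v)

variable {G : MeanPayoffGame V}

theorem StronglyConnected.exists_edge (hG : G.StronglyConnected) (v : V) : ∃ u, G.edge v u := by
  obtain ⟨u, hu, -⟩ := (Relation.TransGen.head'_iff).1 (hG v v)
  exact ⟨u, hu⟩

/-- The value `c` of the optimality equation is locally Lipschitz in `r`. -/
theorem IsPotential.exists_lipschitz [Finite V] [Nonempty V] {r c : ℝ} {h : V → ℝ} {up down : V → V}
    (hp : G.IsPotential r c h up down) :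
    ∃ D : ℝ, 0 ≤ D ∧ ∀ r' c' h' up' down', 0 ≤ r' → r' ≤ 1 → G.IsPotential r' c' h' up' down' →
      |c' - c| ≤ |r' - r| * D := by
  obtain ⟨D, hD⟩ := (Set.finite_range fun v => h (up v) - h (down v)).bddAbove
  have hD' : ∀ v, h (up v) - h (down v) ≤ D := fun v => hD ⟨v, rfl⟩
  have hnn : ∀ v, 0 ≤ h (up v) - h (down v) := fun v =>
    sub_nonneg.2 (hp.le_up _ _ (hp.edge_down v))
  refine ⟨D, (hnn (Classical.arbitrary V)).trans (hD' _), ?_⟩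
  intro r' c' h' up' down' hr₀ hr₁ hp'
  have hT : ∀ v, |(r' - r) * (h (up v) - h (down v))| ≤ |r' - r| * D := fun v => by
    rw [abs_mul, abs_of_nonneg (hnn v)]
    exact mul_le_mul_of_nonneg_left (hD' v) (abs_nonneg _)
  have hr₁' : 0 ≤ 1 - r' := by linarith
  rw [abs_le]
  constructor
  -- Maximum principle: where `h' - h` is minimal, replacing `up'` by `up` and `down` by `down'` in
  -- the two equations leaves only the term in `r' - r`.
  · obtain ⟨v, hv⟩ := Finite.exists_min fun v => h' v - h v
    have e₁ := mul_le_mul_of_nonneg_left (hp'.le_up v _ (hp.edge_up v)) hr₀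
    have e₂ := mul_le_mul_of_nonneg_left (hv (up v)) hr₀
    have e₃ := mul_le_mul_of_nonneg_left (hp.down_le v _ (hp'.edge_down v)) hr₁'
    have e₄ := mul_le_mul_of_nonneg_left (hv (down' v)) hr₁'
    have := (abs_le.1 (hT v)).1
    linarith [hp.eq v, hp'.eq v]
  · obtain ⟨v, hv⟩ := Finite.exists_max fun v => h' v - h v
    have e₁ := mul_le_mul_of_nonneg_left (hp.le_up v _ (hp'.edge_up v)) hr₀
    have e₂ := mul_le_mul_of_nonneg_left (hv (up' v)) hr₀
    have e₃ := mul_le_mul_of_nonneg_left (hp'.down_le v _ (hp.edge_down v)) hr₁'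
    have e₄ := mul_le_mul_of_nonneg_left (hv (down v)) hr₁'
    have := (abs_le.1 (hT v)).2
    linarith [hp.eq v, hp'.eq v]

/-- In a strongly-connected graph, a function with a nonpositive value that grows at most by an
affine factor along the edges is bounded. -/
theorem StronglyConnected.exists_bound [Finite V] (hG : G.StronglyConnected) {q : ℝ} (hq : 0 < q)
    (A : ℝ) : ∃ C : ℝ, ∀ d : V → ℝ, (∃ v, d v ≤ 0) →
      (∀ v u, G.edge v u → q * d u ≤ d v + A) → ∀ u, d u ≤ C := by
  have h₁ : ∀ v u : V, ∃ C : ℝ, ∀ d : V → ℝ, d v ≤ 0 →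
      (∀ v u, G.edge v u → q * d u ≤ d v + A) → d u ≤ C := by
    intro v u
    induction hG v u with
    | single e =>
      exact ⟨A / q, fun d h₀ hd => (le_div_iff₀' hq).2 (by linarith [hd _ _ e])⟩
    | tail _ e ih =>
      obtain ⟨C, hC⟩ := ih
      exact ⟨(C + A) / q, fun d h₀ hd => (le_div_iff₀' hq).2 (by linarith [hd _ _ e, hC d h₀ hd])⟩
  choose C hC using h₁
  obtain ⟨M, hM⟩ := (Set.finite_range fun x : V × V => C x.1 x.2).bddAbove
  exact ⟨M, fun d ⟨v, hv⟩ hd u => (hC v u d hv hd).trans (hM ⟨(v, u), rfl⟩)⟩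

/-! ### Solving the optimality equation by vanishing discount -/

section Bellman

variable [Fintype V]

/-- The neighbors of a vertex. -/
def neighbors (G : MeanPayoffGame V) (v : V) : Finset V := (Set.toFinite {u | G.edge v u}).toFinset

theorem mem_neighbors {v u : V} : u ∈ G.neighbors v ↔ G.edge v u := by simp [neighbors]

theorem StronglyConnected.neighbors_nonempty (hG : G.StronglyConnected) (v : V) :
    (G.neighbors v).Nonempty :=
  (hG.exists_edge v).imp fun _ => mem_neighbors.2

/-- The one-step optimality operator of the random-turn game. -/
def bellman (hG : G.StronglyConnected) (r : ℝ) (h : V → ℝ) (v : V) : ℝ :=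
  G.weight v + r * (G.neighbors v).sup' (hG.neighbors_nonempty v) h +
    (1 - r) * (G.neighbors v).inf' (hG.neighbors_nonempty v) h

theorem bellman_add_const (hG : G.StronglyConnected) (r : ℝ) (h : V → ℝ) (m : ℝ) (v : V) :
    bellman hG r (fun u => h u + m) v = bellman hG r h v + m := by
  have h₁ : (G.neighbors v).sup' (hG.neighbors_nonempty v) (fun u => h u + m) =
      (G.neighbors v).sup' (hG.neighbors_nonempty v) h + m := by
    apply le_antisymm
    · exact Finset.sup'_le _ _ fun u hu => add_le_add_left (Finset.le_sup' h hu) m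
    · obtain ⟨u, hu, e⟩ := Finset.exists_mem_eq_sup' (hG.neighbors_nonempty v) h
      rw [e]
      exact Finset.le_sup' (fun u => h u + m) hu
  have h₂ : (G.neighbors v).inf' (hG.neighbors_nonempty v) (fun u => h u + m) =
      (G.neighbors v).inf' (hG.neighbors_nonempty v) h + m := by
    apply le_antisymm
    · obtain ⟨u, hu, e⟩ := Finset.exists_mem_eq_inf' (hG.neighbors_nonempty v) h
      rw [e]
      exact Finset.inf'_le (fun u => h u + m) hu
    · exact Finset.le_inf' _ _ fun u hu => add_le_add_left (Finset.inf'_le h hu) m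
  rw [bellman, bellman, h₁, h₂]
  ring

theorem bellman_mono (hG : G.StronglyConnected) {r : ℝ} (hr₀ : 0 ≤ r) (hr₁ : r ≤ 1)
    {h h' : V → ℝ} (hle : h ≤ h') (v : V) : bellman hG r h v ≤ bellman hG r h' v := by
  have h₁ : (G.neighbors v).sup' (hG.neighbors_nonempty v) h ≤
      (G.neighbors v).sup' (hG.neighbors_nonempty v) h' :=
    Finset.sup'_le _ _ fun u hu => (hle u).trans (Finset.le_sup' h' hu)
  have h₂ : (G.neighbors v).inf' (hG.neighbors_nonempty v) h ≤
      (G.neighbors v).inf' (hG.neighbors_nonempty v) h' :=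
    Finset.le_inf' _ _ fun u hu => (Finset.inf'_le h hu).trans (hle u)
  have h₃ := mul_le_mul_of_nonneg_left h₁ hr₀
  have h₄ := mul_le_mul_of_nonneg_left h₂ (sub_nonneg.2 hr₁)
  unfold bellman
  linarith

theorem lipschitzWith_bellman (hG : G.StronglyConnected) {r : ℝ} (hr₀ : 0 ≤ r) (hr₁ : r ≤ 1) :
    LipschitzWith 1 (bellman hG r) := by
  have key : ∀ h h' : V → ℝ, ∀ v, bellman hG r h v ≤ bellman hG r h' v + dist h h' := by
    intro h h' v
    rw [← bellman_add_const]
    refine bellman_mono hG hr₀ hr₁ (fun u => ?_) v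
    have := (le_abs_self _).trans (dist_le_pi_dist h h' u)
    linarith
  refine LipschitzWith.of_dist_le_mul fun h h' => ?_
  rw [NNReal.coe_one, one_mul, dist_pi_le_iff dist_nonneg]
  intro v
  rw [Real.dist_eq, abs_le]
  have h₁ := key h h' v
  have h₂ := key h' h v
  rw [dist_comm] at h₂
  constructor <;> linarith

theorem le_bellman (hG : G.StronglyConnected) {r m : ℝ} (hr₀ : 0 ≤ r) (hr₁ : r ≤ 1)
    {h : V → ℝ} (hm : ∀ u, m ≤ h u) {v u : V} (hu : G.edge v u) :
    G.weight v + r * h u + (1 - r) * m ≤ bellman hG r h v := by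
  have h₁ := mul_le_mul_of_nonneg_left
    (Finset.le_sup' h (mem_neighbors.2 hu) : _ ≤ (G.neighbors v).sup' (hG.neighbors_nonempty v) h)
    hr₀
  have h₂ := mul_le_mul_of_nonneg_left
    (Finset.le_inf' (hG.neighbors_nonempty v) h fun u _ => hm u) (sub_nonneg.2 hr₁)
  unfold bellman
  linarith

theorem bellman_le (hG : G.StronglyConnected) {r m : ℝ} (hr₀ : 0 ≤ r) (hr₁ : r ≤ 1)
    {h : V → ℝ} (hm : ∀ u, h u ≤ m) {v u : V} (hu : G.edge v u) :
    bellman hG r h v ≤ G.weight v + r * m + (1 - r) * h u := by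
  have h₁ := mul_le_mul_of_nonneg_left
    (Finset.sup'_le (hG.neighbors_nonempty v) h fun u _ => hm u) hr₀
  have h₂ := mul_le_mul_of_nonneg_left
    (Finset.inf'_le h (mem_neighbors.2 hu) : (G.neighbors v).inf' (hG.neighbors_nonempty v) h ≤ _)
    (sub_nonneg.2 hr₁)
  unfold bellman
  linarith

/-- The discounted optimality equation. -/
theorem exists_discounted (hG : G.StronglyConnected) {r l : ℝ} (hr₀ : 0 ≤ r) (hr₁ : r ≤ 1)
    (hl₀ : 0 ≤ l) (hl₁ : l < 1) : ∃ h : V → ℝ, bellman hG r (l • h) = h := by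
  lift l to NNReal using hl₀
  have hc : ContractingWith l fun h : V → ℝ => bellman hG r ((l : ℝ) • h) := by
    refine ⟨mod_cast hl₁, ?_⟩
    have := (lipschitzWith_bellman hG hr₀ hr₁).comp
      (LipschitzWith.of_dist_le_mul (K := l) (f := fun h : V → ℝ => (l : ℝ) • h) fun h h' => by
        rw [dist_smul₀, NNReal.norm_eq])
    rwa [one_mul] at this
  exact ⟨hc.fixedPoint, hc.fixedPoint_isFixedPt⟩

/-- The solutions of the discounted equations have bounded oscillation, uniformly in the
discount factor. -/
theorem exists_oscillation_bound (hG : G.StronglyConnected) {r W : ℝ} (hr₀ : 0 ≤ r)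
    (hr₁ : r ≤ 1) (hW : ∀ v, |G.weight v| ≤ W) :
    ∃ C : ℝ, ∀ l h, 1 / 2 ≤ l → l < 1 → bellman hG r (l • h) = h →
      (∀ v, (1 - l) * |h v| ≤ W) ∧ ∀ u v, h u - h v ≤ C := by
  have habs : ∀ l h, 1 / 2 ≤ l → l < 1 → bellman hG r (l • h) = h →
      ∀ v, (1 - l) * |h v| ≤ W := by
    intro l h hl₀ hl₁ hfix v
    have : Nonempty V := ⟨v⟩
    obtain ⟨M, hM⟩ := Finite.exists_max h
    obtain ⟨m, hm⟩ := Finite.exists_min h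
    obtain ⟨u₁, hu₁⟩ := hG.exists_edge M
    obtain ⟨u₂, hu₂⟩ := hG.exists_edge m
    have hl : 0 ≤ l := by linarith
    have e₁ := bellman_le hG hr₀ hr₁ (h := l • h) (m := l * h M)
      (fun u => mul_le_mul_of_nonneg_left (hM u) hl) hu₁
    have e₂ := le_bellman hG hr₀ hr₁ (h := l • h) (m := l * h m)
      (fun u => mul_le_mul_of_nonneg_left (hm u) hl) hu₂
    rw [hfix, Pi.smul_apply, smul_eq_mul] at e₁ e₂
    have e₃ := mul_le_mul_of_nonneg_left
      (mul_le_mul_of_nonneg_left (hM u₁) hl) (sub_nonneg.2 hr₁)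
    have e₄ := mul_le_mul_of_nonneg_left (mul_le_mul_of_nonneg_left (hm u₂) hl) hr₀
    have w₁ := (abs_le.1 (hW M)).2
    have w₂ := (abs_le.1 (hW m)).1
    have f₁ : (1 - l) * h M ≤ W := by linarith
    have f₂ : -W ≤ (1 - l) * h m := by linarith
    have g₁ := mul_le_mul_of_nonneg_left (hM v) (sub_nonneg.2 hl₁.le)
    have g₂ := mul_le_mul_of_nonneg_left (hm v) (sub_nonneg.2 hl₁.le)
    have : |(1 - l) * h v| ≤ W := abs_le.2 ⟨by linarith, by linarith⟩
    rwa [abs_mul, abs_of_nonneg (sub_nonneg.2 hl₁.le)] at this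
  -- For `r > 0`, Max's share of an edge transfers height above the minimum with factor `r l ≥ r /
  -- 2`. This degenerates at `r = 0`, where Min moves alone and depth below the maximum is
  -- transferred with factor `l ≥ 1 / 2`.
  obtain hr | hr := hr₀.eq_or_lt
  · subst hr
    obtain ⟨C, hC⟩ := hG.exists_bound (q := 1 / 2) (by norm_num) (2 * W)
    refine ⟨C, fun l h hl₀ hl₁ hfix => ⟨habs l h hl₀ hl₁ hfix, fun u v => ?_⟩⟩
    have : Nonempty V := ⟨v⟩
    have hl : 0 ≤ l := by linarith
    obtain ⟨M, hM⟩ := Finite.exists_max h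
    have := hC (fun x => h M - h x) ⟨M, by simp⟩ (fun x y hxy => ?_) v
    · linarith [hM u]
    · have e₁ := bellman_le hG hr₀ hr₁ (h := l • h) (m := l * h M)
        (fun u => mul_le_mul_of_nonneg_left (hM u) hl) hxy
      rw [hfix, Pi.smul_apply, smul_eq_mul] at e₁
      have w₁ := (abs_le.1 (hW x)).2
      have e₂ := habs l h hl₀ hl₁ hfix M
      have e₃ := mul_le_mul_of_nonneg_left (neg_abs_le (h M)) (sub_nonneg.2 hl₁.le)
      have e₄ : 0 ≤ (l - 1 / 2) * (h M - h y) :=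
        mul_nonneg (by linarith) (by linarith [hM y])
      linarith
  · obtain ⟨C, hC⟩ := hG.exists_bound (q := r / 2) (by linarith) (2 * W)
    refine ⟨C, fun l h hl₀ hl₁ hfix => ⟨habs l h hl₀ hl₁ hfix, fun u v => ?_⟩⟩
    have : Nonempty V := ⟨v⟩
    have hl : 0 ≤ l := by linarith
    obtain ⟨m, hm⟩ := Finite.exists_min h
    have := hC (fun x => h x - h m) ⟨m, by simp⟩ (fun x y hxy => ?_) u
    · linarith [hm v]
    · have e₁ := le_bellman hG hr₀ hr₁ (h := l • h) (m := l * h m)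
        (fun u => mul_le_mul_of_nonneg_left (hm u) hl) hxy
      rw [hfix, Pi.smul_apply, smul_eq_mul] at e₁
      have w₁ := (abs_le.1 (hW x)).1
      have e₂ := habs l h hl₀ hl₁ hfix m
      have e₃ := mul_le_mul_of_nonneg_left (le_abs_self (h m)) (sub_nonneg.2 hl₁.le)
      have e₄ : 0 ≤ (l - 1 / 2) * (r * (h y - h m)) :=
        mul_nonneg (by linarith) (mul_nonneg hr₀ (by linarith [hm y]))
      linarith

/-- Normalized to vanish at `v₀`, the discounted solutions `k n` stay in a compact box, as do the
numbers `(1 - l n) * h n v₀`. A limit point of the pairs solves the undiscounted equation, by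
continuity of `bellman`. -/
theorem exists_bellman_eq (hG : G.StronglyConnected) [Nonempty V] {r : ℝ} (hr₀ : 0 ≤ r)
    (hr₁ : r ≤ 1) : ∃ (c : ℝ) (h : V → ℝ), ∀ v, h v + c = bellman hG r h v := by
  obtain ⟨W, hW⟩ := (Set.finite_range fun v => |G.weight v|).bddAbove
  obtain ⟨C, hC⟩ := exists_oscillation_bound hG hr₀ hr₁ (W := W) fun v => hW ⟨v, rfl⟩
  -- The shift by two ensures `l n ≥ 1 / 2` from the start.
  let l : ℕ → ℝ := fun n => 1 - 1 / ((n : ℝ) + 2)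
  have hl₀ : ∀ n, 1 / 2 ≤ l n := fun n => by
    have : 1 / ((n : ℝ) + 2) ≤ 1 / 2 :=
      one_div_le_one_div_of_le (by norm_num) (by linarith [n.cast_nonneg (α := ℝ)])
    simp only [l]
    linarith
  have hl₁ : ∀ n, l n < 1 := fun n => by
    have : 0 < 1 / ((n : ℝ) + 2) := by positivity
    simp only [l]
    linarith
  have hlim : Filter.Tendsto l Filter.atTop (nhds 1) := by
    have h₁ : Filter.Tendsto (fun n : ℕ => 1 / ((n : ℝ) + 2)) Filter.atTop (nhds 0) := by
      simp only [one_div]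
      exact (tendsto_natCast_atTop_atTop.atTop_add tendsto_const_nhds).inv_tendsto_atTop
    simpa only [sub_zero] using h₁.const_sub 1
  choose h hh using fun n =>
    exists_discounted hG hr₀ hr₁ ((by norm_num : (0 : ℝ) ≤ 1 / 2).trans (hl₀ n)) (hl₁ n)
  let v₀ := Classical.arbitrary V
  let k : ℕ → V → ℝ := fun n v => h n v - h n v₀
  have hk : ∀ n v, k n v + (1 - l n) * h n v₀ = bellman hG r (l n • k n) v := by
    intro n v
    have h₁ : l n • h n = fun u => (l n • k n) u + l n * h n v₀ := by
      ext u
      simp only [Pi.smul_apply, smul_eq_mul, k]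
      ring
    have h₂ := congrFun (hh n) v
    rw [h₁, bellman_add_const] at h₂
    simp only [k] at h₂ ⊢
    linarith
  have hmem : ∀ n, (k n, (1 - l n) * h n v₀) ∈
      (Set.univ.pi fun _ : V => Set.Icc (-C) C) ×ˢ Set.Icc (-W) W := by
    intro n
    obtain ⟨h₁, h₂⟩ := hC (l n) (h n) (hl₀ n) (hl₁ n) (hh n)
    refine ⟨fun v _ => ⟨?_, h₂ v v₀⟩, abs_le.1 ?_⟩
    · have := h₂ v₀ v
      simp only [k]
      linarith
    · rw [abs_mul, abs_of_nonneg (sub_nonneg.2 (hl₁ n).le)]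
      exact h₁ v₀
  obtain ⟨⟨k', c⟩, -, φ, hφ, ht⟩ :=
    ((isCompact_univ_pi fun _ : V => isCompact_Icc).prod isCompact_Icc).tendsto_subseq hmem
  have ht₁ : Filter.Tendsto (k ∘ φ) Filter.atTop (nhds k') :=
    (continuous_fst.tendsto (k', c)).comp ht
  have ht₂ : Filter.Tendsto (fun n => (1 - l (φ n)) * h (φ n) v₀) Filter.atTop (nhds c) :=
    (continuous_snd.tendsto (k', c)).comp ht
  have ht₃ : Filter.Tendsto (fun n => bellman hG r (l (φ n) • k (φ n))) Filter.atTop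
      (nhds (bellman hG r k')) := by
    have := (hlim.comp hφ.tendsto_atTop).smul ht₁
    rw [one_smul] at this
    exact ((lipschitzWith_bellman hG hr₀ hr₁).continuous.tendsto k').comp this
  refine ⟨c, k', fun v => ?_⟩
  refine tendsto_nhds_unique (((tendsto_pi_nhds.1 ht₁) v).add ht₂) ?_
  refine ((tendsto_pi_nhds.1 ht₃) v).congr fun n => ?_
  exact (hk (φ n) v).symm

end Bellman

theorem StronglyConnected.exists_isPotential [Finite V] [Nonempty V] (hG : G.StronglyConnected)
    {r : ℝ} (hr₀ : 0 ≤ r) (hr₁ : r ≤ 1) : ∃ c h up down, G.IsPotential r c h up down := by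
  have := Fintype.ofFinite V
  obtain ⟨c, h, hh⟩ := exists_bellman_eq hG hr₀ hr₁
  choose up hup hup' using fun v => Finset.exists_mem_eq_sup' (hG.neighbors_nonempty v) h
  choose down hdown hdown' using fun v => Finset.exists_mem_eq_inf' (hG.neighbors_nonempty v) h
  refine ⟨c, h, up, down, fun v => mem_neighbors.1 (hup v), fun v => mem_neighbors.1 (hdown v),
    fun v u hu => ?_, fun v u hu => ?_, fun v => ?_⟩
  · rw [← hup']
    exact Finset.le_sup' h (mem_neighbors.2 hu)
  · rw [← hdown']
    exact Finset.inf'_le h (mem_neighbors.2 hu)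
  · rw [hh, bellman, hup', hdown']

end MeanPayoffGame

/-! ### The payoff of a path -/

section Payoff

variable {S : Type*}

theorem exists_abs_le [Finite S] (w : S → ℝ) : ∃ W, 0 ≤ W ∧ ∀ s, |w s| ≤ W := by
  obtain ⟨W, hW⟩ := (Set.finite_range fun s => |w s|).bddAbove
  exact ⟨|W|, abs_nonneg _, fun s => (hW ⟨s, rfl⟩).trans (le_abs_self W)⟩

theorem abs_energy_div_le {w : S → ℝ} {W : ℝ} (hW : ∀ s, |w s| ≤ W) (π : ℕ → S) (n : ℕ) :
    |energy w π n / n| ≤ W := by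
  have hW₀ : 0 ≤ W := (abs_nonneg _).trans (hW (π 0))
  rw [abs_div, Nat.abs_cast]
  refine div_le_of_le_mul₀ (Nat.cast_nonneg n) hW₀ ?_
  calc |energy w π n| ≤ ∑ i ∈ Finset.range (n - 1), |w (π i)| := Finset.abs_sum_le_sum_abs _ _
    _ ≤ ∑ _i ∈ Finset.range (n - 1), W := Finset.sum_le_sum fun i _ => hW _
    _ = ((n - 1 : ℕ) : ℝ) * W := by simp
    _ ≤ n * W := by
      gcongr
      omega
    _ = W * n := mul_comm _ _

theorem isBoundedUnder_le_energy_div [Finite S] (w : S → ℝ) (π : ℕ → S) :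
    Filter.IsBoundedUnder (· ≤ ·) Filter.atTop fun n : ℕ => energy w π n / n := by
  obtain ⟨W, -, hW⟩ := exists_abs_le w
  exact Filter.isBoundedUnder_of ⟨W, fun n => (abs_le.1 (abs_energy_div_le hW π n)).2⟩

theorem isBoundedUnder_ge_energy_div [Finite S] (w : S → ℝ) (π : ℕ → S) :
    Filter.IsBoundedUnder (· ≥ ·) Filter.atTop fun n : ℕ => energy w π n / n := by
  obtain ⟨W, -, hW⟩ := exists_abs_le w
  exact Filter.isBoundedUnder_of ⟨-W, fun n => (abs_le.1 (abs_energy_div_le hW π n)).1⟩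

theorem abs_payoff_le [Finite S] {w : S → ℝ} {W : ℝ} (hW : ∀ s, |w s| ≤ W) (π : ℕ → S) :
    |payoff w π| ≤ W := by
  refine abs_le.2 ⟨?_, ?_⟩
  · exact Filter.le_liminf_of_le (isBoundedUnder_le_energy_div w π).isCoboundedUnder_ge
      (.of_forall fun n => (abs_le.1 (abs_energy_div_le hW π n)).1)
  · exact Filter.liminf_le_of_le (isBoundedUnder_ge_energy_div w π) fun b hb => by
      obtain ⟨n, hn⟩ := hb.exists
      exact hn.trans (abs_le.1 (abs_energy_div_le hW π n)).2

theorem tendsto_affine_div (c K : ℝ) :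
    Filter.Tendsto (fun n : ℕ => (c * n + K) / n) Filter.atTop (nhds c) := by
  have h₁ : Filter.Tendsto (fun n : ℕ => c + K / n) Filter.atTop (nhds c) := by
    simpa only [add_zero] using (tendsto_const_div_atTop_nhds_zero_nat K).const_add c
  refine h₁.congr' ?_
  filter_upwards [Filter.eventually_ne_atTop 0] with n hn
  field_simp

theorem le_payoff [Finite S] {w : S → ℝ} {π : ℕ → S} {c K : ℝ}
    (h : ∀ᶠ n : ℕ in Filter.atTop, c * n - K ≤ energy w π n) : c ≤ payoff w π := by
  have ht := tendsto_affine_div c (-K)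
  rw [← ht.liminf_eq]
  refine Filter.liminf_le_liminf ?_ ht.isBoundedUnder_ge
    (isBoundedUnder_le_energy_div w π).isCoboundedUnder_ge
  filter_upwards [h] with n hn
  exact div_le_div_of_nonneg_right (by linarith) n.cast_nonneg

theorem payoff_le [Finite S] {w : S → ℝ} {π : ℕ → S} {c K : ℝ}
    (h : ∀ᶠ n : ℕ in Filter.atTop, energy w π n ≤ c * n + K) : payoff w π ≤ c := by
  have ht := tendsto_affine_div c K
  rw [← ht.liminf_eq]
  refine Filter.liminf_le_liminf ?_ (isBoundedUnder_ge_energy_div w π)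
    ht.isBoundedUnder_le.isCoboundedUnder_ge
  filter_upwards [h] with n hn
  exact div_le_div_of_nonneg_right hn n.cast_nonneg

/-- The term `|c|` pays for the last vertex, which the energy omits. -/
theorem sub_le_energy {w : S → ℝ} {π : ℕ → S} {c K : ℝ} {n : ℕ}
    (h : -K ≤ ∑ i ∈ Finset.range (n - 1), (w (π i) - c)) : c * n - (K + |c|) ≤ energy w π n := by
  rw [Finset.sum_sub_distrib, Finset.sum_const, Finset.card_range, nsmul_eq_mul] at h
  change -K ≤ energy w π n - _ at h
  rcases n with - | n
  · simp only [Nat.cast_zero, Nat.zero_sub, zero_mul, mul_zero] at h ⊢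
    linarith [abs_nonneg c]
  · simp only [Nat.add_sub_cancel] at h
    push_cast
    linarith [le_abs_self c]

theorem energy_le_add {w : S → ℝ} {π : ℕ → S} {c K : ℝ} {n : ℕ}
    (h : -K ≤ ∑ i ∈ Finset.range (n - 1), (c - w (π i))) : energy w π n ≤ c * n + (K + |c|) := by
  rw [Finset.sum_sub_distrib, Finset.sum_const, Finset.card_range, nsmul_eq_mul] at h
  change -K ≤ _ - energy w π n at h
  rcases n with - | n
  · simp only [Nat.cast_zero, Nat.zero_sub, zero_mul, mul_zero] at h ⊢
    linarith [abs_nonneg c]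
  · simp only [Nat.add_sub_cancel] at h
    push_cast
    linarith [neg_abs_le c]

theorem measurable_payoff [MeasurableSpace S] [DiscreteMeasurableSpace S] (w : S → ℝ) :
    Measurable (payoff w) := by
  refine Measurable.liminf fun n => Measurable.div_const ?_ _
  exact Finset.measurable_sum _ fun i _ =>
    (Measurable.of_discrete (f := w)).comp (measurable_pi_apply i)

theorem abs_integral_payoff_le [Finite S] [MeasurableSpace S] {w : S → ℝ} {W : ℝ}
    (hW : ∀ s, |w s| ≤ W) (μ : Measure (ℕ → S)) [IsProbabilityMeasure μ] : |∫ π, payoff w π ∂μ| ≤ W := by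
  have := norm_integral_le_of_norm_le_const (μ := μ) (f := payoff w)
    (.of_forall fun π => abs_payoff_le hW π)
  simpa using this

end Payoff

/-! ### Expected payoffs from potentials with signed drift -/

namespace StochasticGame

variable {S : Type*} [MeasurableSpace S] [Finite S] [DiscreteMeasurableSpace S]

instance (G : StochasticGame S) (f : G.Strategy .max) (g : G.Strategy .min) (s : S) :
    IsProbabilityMeasure (G.law f g s) := by
  unfold law; infer_instance

/-- Bounded increments with mean at least `δ` have an exponential moment below one for small `θ`, by
`exp t ≤ 1 + t + t ^ 2` on `[-1, 1]`. -/
theorem one_step_bound (a H : S → ℝ) {δ : ℝ} (hδ : 0 < δ) :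
    ∃ θ q : ℝ, 0 < θ ∧ q < 1 ∧ ∀ (μ : Measure S) [IsProbabilityMeasure μ] (s : S),
      0 ≤ ∫ y, (a s + H y - H s) ∂μ →
        ∫ y, Real.exp (-θ * (a s + δ + H y - H s)) ∂μ ≤ q := by
  obtain ⟨A, hA₀, hA⟩ := exists_abs_le a
  obtain ⟨B, hB₀, hB⟩ := exists_abs_le H
  obtain ⟨C, hC₁, hC⟩ : ∃ C : ℝ, 1 ≤ C ∧ ∀ s y, |a s + δ + H y - H s| ≤ C := by
    refine ⟨A + δ + 2 * B + 1, by linarith, fun s y => abs_le.2 ?_⟩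
    have h₁ := abs_le.1 (hA s)
    have h₂ := abs_le.1 (hB s)
    have h₃ := abs_le.1 (hB y)
    constructor <;> linarith
  have hC₀ : 0 < C := by linarith
  -- The first bound keeps the exponent in `[-1, 1]`; the second makes the quadratic term at most
  -- half of the linear gain `θ δ`.
  set θ := min (1 / C) (δ / (2 * C ^ 2)) with hθ
  have hθ₀ : 0 < θ := lt_min (by positivity) (by positivity)
  have hθ₁ : θ * C ≤ 1 := (le_div_iff₀ hC₀).1 (min_le_left _ _)
  have hθ₂ : θ * (2 * C ^ 2) ≤ δ := (le_div_iff₀ (by positivity)).1 (min_le_right _ _)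
  refine ⟨θ, 1 - θ * δ / 2, hθ₀, by linarith [mul_pos hθ₀ hδ], ?_⟩
  intro μ _ s hs
  have hpt : ∀ y, Real.exp (-θ * (a s + δ + H y - H s)) ≤
      1 - θ * δ / 2 - θ * (a s + H y - H s) := by
    intro y
    set t := a s + δ + H y - H s with ht
    have htC : |t| ≤ C := hC s y
    have h₁ : |-θ * t| ≤ 1 := by
      rw [abs_mul, abs_neg, abs_of_pos hθ₀]
      exact (mul_le_mul_of_nonneg_left htC hθ₀.le).trans hθ₁
    have h₂ := (abs_le.1 (Real.abs_exp_sub_one_sub_id_le h₁)).2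
    have h₃ : t ^ 2 ≤ C ^ 2 := sq_le_sq' (by linarith [(abs_le.1 htC).1]) (abs_le.1 htC).2
    have h₄ : (-θ * t) ^ 2 ≤ θ * δ / 2 := by
      have h₅ := mul_le_mul_of_nonneg_left h₃ (sq_nonneg θ)
      have h₆ := mul_le_mul_of_nonneg_left hθ₂ hθ₀.le
      linarith
    have h₇ : θ * t = θ * (a s + H y - H s) + θ * δ := by rw [ht]; ring
    linarith
  calc ∫ y, Real.exp (-θ * (a s + δ + H y - H s)) ∂μ
      ≤ ∫ y, (1 - θ * δ / 2 - θ * (a s + H y - H s)) ∂μ :=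
        integral_mono .of_finite .of_finite hpt
    _ = 1 - θ * δ / 2 - θ * ∫ y, (a s + H y - H s) ∂μ := by
        rw [integral_sub .of_finite .of_finite, integral_const_mul]
        simp
    _ ≤ 1 - θ * δ / 2 := by linarith [mul_nonneg hθ₀.le hs]

/-- If `a + H` has nonnegative drift at each step, then almost surely, for each `δ > 0`,
the process `∑ (a + δ) + H` is eventually nonnegative. -/
theorem ae_eventually_nonneg (G : StochasticGame S) (f : G.Strategy .max) (g : G.Strategy .min)
    (s : S) (a H : S → ℝ)
    (hstep : ∀ n (x : Finset.Iic n → S),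
      0 ≤ ∫ y, (a (last x) + H y - H (last x)) ∂(G.step f g n x))
    {δ : ℝ} (hδ : 0 < δ) :
    ∀ᵐ π ∂(G.law f g s), ∀ᶠ n : ℕ in Filter.atTop,
      0 ≤ ∑ i ∈ Finset.range n, (a (π i) + δ) + H (π n) := by
  obtain ⟨θ, q, hθ, hq, hone⟩ := one_step_bound a H hδ
  obtain ⟨B, hB₀, hB⟩ := exists_abs_le H
  set Z : ℕ → (ℕ → S) → ENNReal := fun n π => ENNReal.ofReal
    (Real.exp (-θ * (∑ i ∈ Finset.range n, (a (π i) + δ) + H (π n)))) with hZ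
  have hmeas : ∀ (φ : S → ℝ) (i : ℕ), Measurable fun π : ℕ → S => φ (π i) := fun φ i =>
    (Measurable.of_discrete (f := φ)).comp (measurable_pi_apply i)
  have hZm : ∀ n, Measurable (Z n) := fun n =>
    ((((Finset.measurable_sum _ fun i _ => (hmeas a i).add_const δ).add (hmeas H n)).const_mul
      (-θ)).exp).ennreal_ofReal
  have hzero : ∫⁻ π, Z 0 π ∂(G.law f g s) ≤ ENNReal.ofReal (Real.exp (θ * B)) := by
    calc ∫⁻ π, Z 0 π ∂(G.law f g s)
        ≤ ∫⁻ _, ENNReal.ofReal (Real.exp (θ * B)) ∂(G.law f g s) := by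
          refine lintegral_mono fun π => ENNReal.ofReal_le_ofReal (Real.exp_le_exp.2 ?_)
          have := mul_le_mul_of_nonneg_left (abs_le.1 (hB (π 0))).1 hθ.le
          simp only [Finset.range_zero, Finset.sum_empty, zero_add]
          linarith
      _ = ENNReal.ofReal (Real.exp (θ * B)) := by simp
  have hsucc : ∀ n, ∫⁻ π, Z (n + 1) π ∂(G.law f g s) ≤
      ENNReal.ofReal q * ∫⁻ π, Z n π ∂(G.law f g s) := by
    intro n
    let z : (Finset.Iic n → S) → ENNReal := fun x => ENNReal.ofReal
      (Real.exp (-θ * (∑ i ∈ (Finset.range n).attach,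
        (a (x ⟨i.1, Finset.mem_Iic.2 (Finset.mem_range.1 i.2).le⟩) + δ) + H (last x))))
    let F : (Finset.Iic n → S) × S → ENNReal := fun p => z p.1 * ENNReal.ofReal
      (Real.exp (-θ * (a (last p.1) + δ + H p.2 - H (last p.1))))
    have hzπ : ∀ π : ℕ → S, z (Preorder.frestrictLe n π) = Z n π := fun π => by
      simp only [z, hZ, last, Preorder.frestrictLe_apply]
      rw [Finset.sum_attach (Finset.range n) fun i => a (π i) + δ]
    have hFπ : ∀ π : ℕ → S, F (Preorder.frestrictLe n π, π (n + 1)) = Z (n + 1) π := fun π => by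
      simp only [F, hzπ]
      simp only [hZ, last, Preorder.frestrictLe_apply]
      rw [← ENNReal.ofReal_mul (Real.exp_pos _).le, ← Real.exp_add, Finset.sum_range_succ]
      congr 2
      ring
    -- The law of a prefix and its next vertex disintegrates through the step kernel, so the
    -- one-step bound applies conditionally.
    have hmap := Kernel.partialTraj_compProd_eq_map_traj (X := fun _ => S) (κ := G.kernel f g)
      (Nat.zero_le n) (x₀ := fun _ => s)
    have hpm : Measurable fun π : ℕ → S =>
        ((Preorder.frestrictLe n π, π (n + 1)) : (Finset.Iic n → S) × S) := by fun_prop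
    have hFm : Measurable F := .of_discrete
    calc ∫⁻ π, Z (n + 1) π ∂(G.law f g s)
        = ∫⁻ π, F (Preorder.frestrictLe n π, π (n + 1)) ∂(G.law f g s) := by simp only [hFπ]
      _ = ∫⁻ p, F p ∂((G.law f g s).map fun π => (Preorder.frestrictLe n π, π (n + 1))) :=
          (lintegral_map hFm hpm).symm
      _ = ∫⁻ x, ∫⁻ y, F (x, y) ∂(G.kernel f g n x)
            ∂(Kernel.partialTraj (X := fun _ => S) (G.kernel f g) 0 n fun _ => s) := by
          rw [law, ← hmap, Measure.lintegral_compProd hFm]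
      _ ≤ ∫⁻ x, z x * ENNReal.ofReal q
            ∂(Kernel.partialTraj (X := fun _ => S) (G.kernel f g) 0 n fun _ => s) := by
          refine lintegral_mono fun x => ?_
          have := G.isProbabilityMeasure_step f g n x
          simp only [F]
          rw [lintegral_const_mul _ .of_discrete]
          refine mul_le_mul_right ?_ (z x)
          change ∫⁻ y, ENNReal.ofReal _ ∂(G.step f g n x) ≤ _
          rw [← ofReal_integral_eq_lintegral_ofReal .of_finite
            (.of_forall fun y => (Real.exp_pos _).le)]
          exact ENNReal.ofReal_le_ofReal (hone _ _ (hstep n x))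
      _ = ENNReal.ofReal q * ∫⁻ π, Z n π ∂(G.law f g s) := by
          rw [lintegral_mul_const _ .of_discrete, mul_comm,
            ← Kernel.traj_map_frestrictLe_apply, lintegral_map .of_discrete (by fun_prop)]
          simp only [hzπ]
          rfl
  have hpow : ∀ n, ∫⁻ π, Z n π ∂(G.law f g s) ≤
      ENNReal.ofReal q ^ n * ENNReal.ofReal (Real.exp (θ * B)) := by
    intro n
    induction n with
    | zero => simpa using hzero
    | succ n ih =>
      rw [pow_succ', mul_assoc]
      exact (hsucc n).trans (mul_le_mul_right ih _)
  have hsum : ∫⁻ π, ∑' n, Z n π ∂(G.law f g s) ≠ ⊤ := by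
    rw [lintegral_tsum fun n => (hZm n).aemeasurable]
    refine ne_top_of_le_ne_top ?_ (ENNReal.tsum_le_tsum hpow)
    rw [ENNReal.tsum_mul_right, ENNReal.tsum_geometric]
    refine ENNReal.mul_ne_top (ENNReal.inv_ne_top.2 ?_) ENNReal.ofReal_ne_top
    exact (tsub_pos_of_lt (ENNReal.ofReal_lt_one.2 hq)).ne'
  -- As in Borel–Cantelli, the expectations are summable, so almost surely `Z n` tends to zero; once
  -- it is below one, the process is positive.
  filter_upwards [ae_lt_top (Measurable.tsum hZm) hsum] with π hπ
  have ht := ENNReal.tendsto_atTop_zero_of_tsum_ne_top hπ.ne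
  filter_upwards [ht.eventually_lt_const one_pos] with n hn
  simp only [hZ] at hn
  rw [ENNReal.ofReal_lt_one, Real.exp_lt_one_iff] at hn
  by_contra! hneg
  linarith [mul_pos_of_neg_of_neg (neg_neg_of_pos hθ) hneg]

theorem integrable_payoff (w : S → ℝ) (μ : Measure (ℕ → S)) [IsFiniteMeasure μ] :
    Integrable (payoff w) μ := by
  obtain ⟨W, -, hW⟩ := exists_abs_le w
  exact .of_bound (measurable_payoff w).aestronglyMeasurable W
    (.of_forall fun π => abs_payoff_le hW π)

/-- A lower bound on the expected payoff from a potential that does not decrease on average. -/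
theorem le_integral_payoff (G : StochasticGame S) (f : G.Strategy .max) (g : G.Strategy .min)
    (s : S) (c : ℝ) (H : S → ℝ)
    (hstep : ∀ n (x : Finset.Iic n → S),
      0 ≤ ∫ y, (G.weight (last x) - c + H y - H (last x)) ∂(G.step f g n x)) :
    c ≤ ∫ π, payoff G.weight π ∂(G.law f g s) := by
  refine le_of_forall_pos_sub_le fun δ hδ => ?_
  obtain ⟨B, -, hB⟩ := exists_abs_le H
  have hae : ∀ᵐ π ∂(G.law f g s), c - δ ≤ payoff G.weight π := by
    filter_upwards [G.ae_eventually_nonneg f g s (fun s => G.weight s - c) H hstep hδ] with π hπ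
    refine le_payoff (K := B + |c - δ|) ?_
    filter_upwards [(Filter.tendsto_sub_atTop_nat 1).eventually hπ] with n hn
    refine sub_le_energy ?_
    have : ∑ i ∈ Finset.range (n - 1), (G.weight (π i) - c + δ) =
        ∑ i ∈ Finset.range (n - 1), (G.weight (π i) - (c - δ)) :=
      Finset.sum_congr rfl fun i _ => by ring
    rw [← this]
    linarith [(abs_le.1 (hB (π (n - 1)))).2]
  have := integral_mono_ae (integrable_const (c - δ)) (integrable_payoff G.weight _) hae
  simpa using this

/-- An upper bound on the expected payoff from a potential that does not increase on average. -/
theorem integral_payoff_le (G : StochasticGame S) (f : G.Strategy .max) (g : G.Strategy .min)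
    (s : S) (c : ℝ) (H : S → ℝ)
    (hstep : ∀ n (x : Finset.Iic n → S),
      0 ≤ ∫ y, (c - G.weight (last x) + H y - H (last x)) ∂(G.step f g n x)) :
    ∫ π, payoff G.weight π ∂(G.law f g s) ≤ c := by
  refine le_of_forall_pos_le_add fun δ hδ => ?_
  obtain ⟨B, -, hB⟩ := exists_abs_le H
  have hae : ∀ᵐ π ∂(G.law f g s), payoff G.weight π ≤ c + δ := by
    filter_upwards [G.ae_eventually_nonneg f g s (fun s => c - G.weight s) H hstep hδ] with π hπ
    refine payoff_le (K := B + |c + δ|) ?_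
    filter_upwards [(Filter.tendsto_sub_atTop_nat 1).eventually hπ] with n hn
    refine energy_le_add ?_
    have : ∑ i ∈ Finset.range (n - 1), (c - G.weight (π i) + δ) =
        ∑ i ∈ Finset.range (n - 1), (c + δ - G.weight (π i)) :=
      Finset.sum_congr rfl fun i _ => by ring
    rw [← this]
    linarith [(abs_le.1 (hB (π (n - 1)))).2]
  have := integral_mono_ae (integrable_payoff G.weight _) (integrable_const (c + δ)) hae
  simpa using this

/-- A number that each player can secure is the value. -/
theorem value_eq (G : StochasticGame S) (s : S) (c : ℝ) (f₀ : G.Strategy .max)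
    (g₀ : G.Strategy .min) (hf : ∀ g, c ≤ ∫ π, payoff G.weight π ∂(G.law f₀ g s))
    (hg : ∀ f, ∫ π, payoff G.weight π ∂(G.law f g₀ s) ≤ c) : G.value s = c := by
  obtain ⟨W, -, hW⟩ := exists_abs_le G.weight
  have hbelow : ∀ f, BddBelow
      (Set.range fun g : G.Strategy .min => ∫ π, payoff G.weight π ∂(G.law f g s)) := fun f =>
    ⟨-W, by rintro _ ⟨g, rfl⟩; exact (abs_le.1 (abs_integral_payoff_le hW _)).1⟩
  have : Nonempty (G.Strategy .max) := ⟨f₀⟩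
  have : Nonempty (G.Strategy .min) := ⟨g₀⟩
  have hle : ∀ f, ⨅ g : G.Strategy .min, ∫ π, payoff G.weight π ∂(G.law f g s) ≤ c := fun f =>
    (ciInf_le (hbelow f) g₀).trans (hg f)
  exact le_antisymm (ciSup_le hle)
    ((le_ciInf hf).trans (le_ciSup (f := fun f : G.Strategy .max =>
      ⨅ g : G.Strategy .min, ∫ π, payoff G.weight π ∂(G.law f g s))
      ⟨c, by rintro _ ⟨f, rfl⟩; exact hle f⟩ f₀))

end StochasticGame

namespace MeanPayoffGame

variable {V : Type*} {G : MeanPayoffGame V}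

theorem sum_le_of_edges {a φ : V → ℝ} (h : ∀ v u, G.edge v u → a v + φ u - φ v ≤ 0)
    {π : ℕ → V} (hπ : ∀ n, G.edge (π n) (π (n + 1))) (n : ℕ) :
    ∑ i ∈ Finset.range n, a (π i) ≤ φ (π 0) - φ (π n) := by
  induction n with
  | zero => simp
  | succ n ih =>
    rw [Finset.sum_range_succ]
    linarith [h _ _ (hπ n)]

variable [Finite V]

/-! ### The value of the random-turn game -/

/-- The potential of a random-turn game that is induced by a solution of the optimality equation.
A round takes two steps, which is why `h` is doubled. -/
def rtPotential (G : MeanPayoffGame V) (c : ℝ) (h : V → ℝ) (up down : V → V) : RTVertex V → ℝ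
  | .maxTurn v => G.weight v - c + 2 * h (up v)
  | .minTurn v => G.weight v - c + 2 * h (down v)
  | .nature v => 2 * h v

/-- The drift of `rtPotential` vanishes at nature's vertices, by the optimality equation, and under
the moves `up` and `down`. Any other move can only shift it in favor of the opponent of the player
making it. -/
theorem IsPotential.value_randomTurn {r : unitInterval} {c : ℝ} {h : V → ℝ} {up down : V → V}
    (hp : G.IsPotential r c h up down) (u : V) : (G.randomTurn r).value (.nature u) = c := by
  have hnature : ∀ s : RTVertex V, s.owner = .nature →
      ∫ y, (G.weight s.base - c + G.rtPotential c h up down y - G.rtPotential c h up down s)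
        ∂(bernoulliMeasure (RTVertex.maxTurn s.base) (RTVertex.minTurn s.base) r) = 0 := by
    intro s hs
    cases s with
    | maxTurn v => cases hs
    | minTurn v => cases hs
    | nature v =>
      rw [integral_bernoulliMeasure]
      simp only [rtPotential, RTVertex.base, smul_eq_mul]
      linear_combination -2 * hp.eq v
  refine StochasticGame.value_eq _ _ c
    ⟨fun n x => .nature (up (StochasticGame.last x).base), fun n x _ => ⟨_, rfl, hp.edge_up _⟩⟩
    ⟨fun n x => .nature (down (StochasticGame.last x).base), fun n x _ => ⟨_, rfl, hp.edge_down _⟩⟩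
    (fun g => StochasticGame.le_integral_payoff _ _ _ _ c (G.rtPotential c h up down)
      fun n x => ?_)
    (fun f => StochasticGame.integral_payoff_le _ _ _ _ c (fun s => -G.rtPotential c h up down s)
      fun n x => ?_)
  · unfold StochasticGame.step
    split
    · rename_i ho
      rw [integral_dirac]
      dsimp only
      change RTVertex.owner _ = _ at ho
      change 0 ≤ G.weight _ - c + _ - _
      generalize StochasticGame.last x = s at *
      cases s with
      | maxTurn v =>
        simp only [rtPotential, RTVertex.base]
        linarith
      | minTurn v => cases ho
      | nature v => cases ho
    · rename_i ho
      rw [integral_dirac]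
      obtain ⟨u, hu, hedge⟩ := g.2 n x ho
      rw [hu]
      change RTVertex.owner _ = _ at ho
      change 0 ≤ G.weight _ - c + _ - _
      generalize StochasticGame.last x = s at *
      cases s with
      | maxTurn v => cases ho
      | minTurn v =>
        simp only [rtPotential, RTVertex.base]
        linarith [hp.down_le v u hedge]
      | nature v => cases ho
    · rename_i ho
      exact (hnature _ ho).ge
  · unfold StochasticGame.step
    split
    · rename_i ho
      rw [integral_dirac]
      obtain ⟨u, hu, hedge⟩ := f.2 n x ho
      rw [hu]
      change RTVertex.owner _ = _ at ho
      change 0 ≤ c - G.weight _ + _ - _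
      generalize StochasticGame.last x = s at *
      cases s with
      | maxTurn v =>
        simp only [rtPotential, RTVertex.base]
        linarith [hp.le_up v u hedge]
      | minTurn v => cases ho
      | nature v => cases ho
    · rename_i ho
      rw [integral_dirac]
      dsimp only
      change RTVertex.owner _ = _ at ho
      change 0 ≤ c - G.weight _ + _ - _
      generalize StochasticGame.last x = s at *
      cases s with
      | maxTurn v => cases ho
      | minTurn v =>
        simp only [rtPotential, RTVertex.base]
        linarith
      | nature v => cases ho
    · rename_i ho
      have := hnature _ ho
      rw [← neg_eq_zero, ← integral_neg] at this
      refine (this.symm.trans (integral_congr_ae (.of_forall fun y => ?_))).le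
      change -(G.weight _ - c + _ - _) = c - G.weight _ + _ - _
      ring

/-! ### Energy bounds in the bidding game -/

/-- A truncated ratio leaves the opponent nothing; otherwise the advantage is `ε (B + C)`. -/
theorem budgets_of_ratio {B C r ε : ℝ} (hr : 0 ≤ r) (hε : 0 < ε) (hBC : 0 < B + C)
    (h : B / (B + C) = min (r + ε) 1) : 0 < B ∧ (C = 0 ∨ 0 < (1 - r) * B - r * C) := by
  rw [div_eq_iff hBC.ne'] at h
  refine ⟨by rw [h]; positivity, ?_⟩
  rcases min_cases (r + ε) 1 with ⟨e, -⟩ | ⟨e, -⟩ <;> rw [e] at h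
  · right
    linarith [mul_pos hε hBC]
  · left
    linarith

theorem IsPotential.maxEnsures {r c : ℝ} {h : V → ℝ} {up down : V → V}
    (hp : G.IsPotential r c h up down) (hr₀ : 0 ≤ r) (hr₁ : r ≤ 1) (tie : TieBreak V) (v : V)
    {ε Bmax Bmin : ℝ} (hε : 0 < ε) (hB : InitialRatio Bmax Bmin (min (r + ε) 1)) :
    ∃ K : ℝ, G.MaxEnsures tie v Bmax Bmin fun π => ∀ n : ℕ, c * n - K ≤ energy G.weight π n := by
  obtain ⟨-, hC, hBC, hratio⟩ := hB
  obtain ⟨hB, hadv⟩ := budgets_of_ratio hr₀ hε hBC hratio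
  obtain ⟨D, -, hD⟩ := exists_abs_le h
  obtain ⟨f, Q, x₀, hf, h₀, hspent, hwin, hlose, hlevel⟩ :=
    exists_strategy_level_ge (G := G) (p := .max) (q := .min) (by simp)
      (a := fun v => G.weight v - c) (φ := h) (s := fun v => h (up v) - h (down v)) (up := up)
      v hp.edge_up hr₀ hr₁ (fun v => sub_nonneg.2 (hp.le_up _ _ (hp.edge_down v)))
      (fun v => by linarith [hp.eq v])
      (fun v u hu => by linarith [hp.eq v, hp.down_le v u hu]) hB hC hadv
  refine ⟨x₀ + 2 * D + |c|, f, hf, fun g hg n => sub_le_energy ?_⟩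
  have hl := hlevel _ (play_induction_max tie h₀ hspent hwin hlose hg (n - 1))
  rw [level_play] at hl
  linarith [(abs_le.1 (hD v)).1, (abs_le.1 (hD (path tie v f g (n - 1)))).2]

/-- Min plays Max's strategy for the negated weights and potential, with `1 - r` for `r` and `down`
for `up`. -/
theorem IsPotential.minEnsures {r c : ℝ} {h : V → ℝ} {up down : V → V}
    (hp : G.IsPotential r c h up down) (hr₀ : 0 ≤ r) (hr₁ : r ≤ 1) (tie : TieBreak V) (v : V)
    {ε Bmax Bmin : ℝ} (hε : 0 < ε) (hB : InitialRatio Bmax Bmin (max (r - ε) 0)) :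
    ∃ K : ℝ, G.MinEnsures tie v Bmax Bmin fun π => ∀ n : ℕ, energy G.weight π n ≤ c * n + K := by
  obtain ⟨hC, -, hBC, hratio⟩ := hB
  have hratio' : Bmin / (Bmin + Bmax) = min (1 - r + ε) 1 := by
    have h₁ : Bmin / (Bmin + Bmax) = 1 - Bmax / (Bmax + Bmin) := by
      rw [add_comm Bmin, eq_sub_iff_add_eq, ← add_div, add_comm Bmin, div_self hBC.ne']
    rw [h₁, hratio, ← min_sub_sub_left]
    congr 1 <;> ring
  obtain ⟨hB, hadv⟩ := budgets_of_ratio (sub_nonneg.2 hr₁) hε (by linarith) hratio'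
  obtain ⟨D, -, hD⟩ := exists_abs_le h
  obtain ⟨g, Q, x₀, hg, h₀, hspent, hwin, hlose, hlevel⟩ :=
    exists_strategy_level_ge (G := G) (p := .min) (q := .max) (by simp)
      (a := fun v => c - G.weight v) (φ := fun v => -h v) (s := fun v => h (up v) - h (down v))
      (up := down) v hp.edge_down (sub_nonneg.2 hr₁) (sub_le_self 1 hr₀)
      (fun v => sub_nonneg.2 (hp.le_up _ _ (hp.edge_down v)))
      (fun v => by linarith [hp.eq v])
      (fun v u hu => by linarith [hp.eq v, hp.le_up v u hu]) hB hC hadv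
  refine ⟨x₀ + 2 * D + |c|, g, hg, fun f hf n => energy_le_add ?_⟩
  have hl := hlevel _ (play_induction_min tie h₀ hspent hwin hlose hf (n - 1))
  rw [level_play] at hl
  linarith [(abs_le.1 (hD v)).2, (abs_le.1 (hD (path tie v f g (n - 1)))).1]

/-! ### Uniqueness of the value -/

/-- If Max wins all biddings, then the value bounds the payoff of every path. -/
theorem IsPotential.payoff_le_of_edges {c : ℝ} {h : V → ℝ} {up down : V → V}
    (hp : G.IsPotential 1 c h up down) {π : ℕ → V} (hπ : ∀ n, G.edge (π n) (π (n + 1))) :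
    payoff G.weight π ≤ c := by
  obtain ⟨D, -, hD⟩ := exists_abs_le h
  refine payoff_le (K := 2 * D + |c|) (.of_forall fun n => energy_le_add ?_)
  have := sum_le_of_edges (a := fun v => G.weight v - c) (φ := h)
    (fun v u hu => by linarith [hp.eq v, hp.le_up v u hu]) hπ (n - 1)
  rw [Finset.sum_sub_distrib] at this ⊢
  linarith [(abs_le.1 (hD (π 0))).2, (abs_le.1 (hD (π (n - 1)))).1]

/-- If Min wins all biddings, then the value bounds the payoff of every path. -/
theorem IsPotential.le_payoff_of_edges {c : ℝ} {h : V → ℝ} {up down : V → V}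
    (hp : G.IsPotential 0 c h up down) {π : ℕ → V} (hπ : ∀ n, G.edge (π n) (π (n + 1))) :
    c ≤ payoff G.weight π := by
  obtain ⟨D, -, hD⟩ := exists_abs_le h
  refine le_payoff (K := 2 * D + |c|) (.of_forall fun n => sub_le_energy ?_)
  have := sum_le_of_edges (a := fun v => c - G.weight v) (φ := fun v => -h v)
    (fun v u hu => by linarith [hp.eq v, hp.down_le v u hu]) hπ (n - 1)
  rw [Finset.sum_sub_distrib] at this ⊢
  linarith [(abs_le.1 (hD (π 0))).1, (abs_le.1 (hD (π (n - 1)))).2]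

theorem IsPotential.isValue {r c : ℝ} {h : V → ℝ} {up down : V → V}
    (hp : G.IsPotential r c h up down) (hr₀ : 0 ≤ r) (hr₁ : r ≤ 1) (tie : TieBreak V) (v : V) :
    G.IsValue tie v r c := by
  refine fun ε hε Bmax Bmin => ⟨fun hB => ?_, fun hB => ?_⟩
  · obtain ⟨K, f, hf, hK⟩ := hp.maxEnsures hr₀ hr₁ tie v hε hB
    exact ⟨f, hf, fun g hg => le_payoff (.of_forall (hK g hg))⟩
  · obtain ⟨K, g, hg, hK⟩ := hp.minEnsures hr₀ hr₁ tie v hε hB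
    exact ⟨g, hg, fun f hf => payoff_le (.of_forall (hK f hf))⟩

/-- At the ratio `r + ε`, Max's guarantee of `c'` meets Min's guarantee of the value for `r + 2 *
ε`, which is within `2 * ε * D` of `c`. -/
theorem IsPotential.value_le (hG : G.StronglyConnected) {r c : ℝ} {h : V → ℝ} {up down : V → V}
    (hp : G.IsPotential r c h up down) (hr₀ : 0 ≤ r) (hr₁ : r ≤ 1) {tie : TieBreak V} {v : V}
    {c' : ℝ} (hc' : G.IsValue tie v r c') : c' ≤ c := by
  have : Nonempty V := ⟨v⟩
  rcases hr₁.eq_or_lt with rfl | hr₁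
  -- No ratio above one is available, but for `r = 1` no path at all has a payoff exceeding `c`.
  · obtain ⟨f, hf, hc⟩ := (hc' 1 one_pos 1 0).1 (by norm_num [InitialRatio])
    obtain ⟨g, hg⟩ := exists_legal hG.exists_edge .min (B := 0)
    exact (hc g hg).trans (hp.payoff_le_of_edges (edge_path tie v hf hg))
  · obtain ⟨D, hD, hlip⟩ := hp.exists_lipschitz
    refine le_of_forall_pos_le_add fun δ hδ => ?_
    obtain ⟨ε, hε, hε₁, hε₂⟩ : ∃ ε, 0 < ε ∧ r + 2 * ε ≤ 1 ∧ 2 * ε * D ≤ δ := by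
      refine ⟨min ((1 - r) / 2) (δ / (2 * (D + 1))),
        lt_min (by linarith) (by positivity), ?_, ?_⟩
      · linarith [min_le_left ((1 - r) / 2) (δ / (2 * (D + 1)))]
      · have h₁ := min_le_right ((1 - r) / 2) (δ / (2 * (D + 1)))
        rw [le_div_iff₀ (by positivity)] at h₁
        have h₂ : 0 < min ((1 - r) / 2) (δ / (2 * (D + 1))) :=
          lt_min (by linarith) (by positivity)
        linarith
    obtain ⟨c₂, h₂, up₂, down₂, hp₂⟩ :=
      hG.exists_isPotential (r := r + 2 * ε) (by linarith) hε₁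
    have hratio : InitialRatio (r + ε) (1 - r - ε) (r + ε) :=
      ⟨by linarith, by linarith, by linarith, by ring_nf⟩
    obtain ⟨f, hf, hcf⟩ := (hc' ε hε (r + ε) (1 - r - ε)).1
      (by rwa [min_eq_left (by linarith)])
    obtain ⟨g, hg, hcg⟩ := (hp₂.isValue (by linarith) hε₁ tie v ε hε (r + ε) (1 - r - ε)).2
      (by
        rw [max_eq_left (by linarith)]
        convert hratio using 1
        ring)
    have h₁ := (hcf g hg).trans (hcg f hf)
    have h₂ := (abs_le.1 (hlip _ _ _ _ _ (by linarith) hε₁ hp₂)).2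
    rw [add_sub_cancel_left, abs_of_pos (by linarith)] at h₂
    linarith

theorem IsPotential.le_value (hG : G.StronglyConnected) {r c : ℝ} {h : V → ℝ} {up down : V → V}
    (hp : G.IsPotential r c h up down) (hr₀ : 0 ≤ r) (hr₁ : r ≤ 1) {tie : TieBreak V} {v : V}
    {c' : ℝ} (hc' : G.IsValue tie v r c') : c ≤ c' := by
  have : Nonempty V := ⟨v⟩
  rcases hr₀.eq_or_lt with rfl | hr₀
  · obtain ⟨g, hg, hc⟩ := (hc' 1 one_pos 0 1).2 (by norm_num [InitialRatio])
    obtain ⟨f, hf⟩ := exists_legal hG.exists_edge .max (B := 0)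
    exact (hp.le_payoff_of_edges (edge_path tie v hf hg)).trans (hc f hf)
  · obtain ⟨D, hD, hlip⟩ := hp.exists_lipschitz
    refine le_of_forall_pos_le_add fun δ hδ => ?_
    obtain ⟨ε, hε, hε₁, hε₂⟩ : ∃ ε, 0 < ε ∧ 0 ≤ r - 2 * ε ∧ 2 * ε * D ≤ δ := by
      refine ⟨min (r / 2) (δ / (2 * (D + 1))), lt_min (by linarith) (by positivity), ?_, ?_⟩
      · linarith [min_le_left (r / 2) (δ / (2 * (D + 1)))]
      · have h₁ := min_le_right (r / 2) (δ / (2 * (D + 1)))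
        rw [le_div_iff₀ (by positivity)] at h₁
        have h₂ : 0 < min (r / 2) (δ / (2 * (D + 1))) := lt_min (by linarith) (by positivity)
        linarith
    obtain ⟨c₂, h₂, up₂, down₂, hp₂⟩ :=
      hG.exists_isPotential (r := r - 2 * ε) hε₁ (by linarith)
    have hratio : InitialRatio (r - ε) (1 - r + ε) (r - ε) :=
      ⟨by linarith, by linarith, by linarith, by ring_nf⟩
    obtain ⟨g, hg, hcg⟩ := (hc' ε hε (r - ε) (1 - r + ε)).2
      (by rwa [max_eq_left (by linarith)])
    obtain ⟨f, hf, hcf⟩ := (hp₂.isValue hε₁ (by linarith) tie v ε hε (r - ε) (1 - r + ε)).1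
      (by
        rw [min_eq_left (by linarith)]
        convert hratio using 1
        ring)
    have h₁ := (hcf g hg).trans (hcg f hf)
    have h₂ := (abs_le.1 (hlip _ _ _ _ _ hε₁ (by linarith) hp₂)).1
    rw [abs_sub_comm, sub_sub_cancel, abs_of_pos (by linarith)] at h₂
    linarith

end MeanPayoffGame

end Poorman

end

open Poorman in
theorem theorem4 {V : Type*} [Finite V] (G : MeanPayoffGame V) (hG : G.StronglyConnected)
    (tie : TieBreak V) (r : unitInterval) (u v : V) :
    -- the value from every vertex exists, is unique, and is the value of the random-turn game
    (∀ c : ℝ, G.IsValue tie v r c ↔ c = (G.randomTurn r).value (.nature u)) ∧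
    -- moreover, it is enforced by bounding the energy relative to the value
    ∀ ε : ℝ, 0 < ε → ∀ Bmax Bmin : ℝ,
      (InitialRatio Bmax Bmin (min (r + ε) 1) → ∃ K : ℝ,
        G.MaxEnsures tie v Bmax Bmin fun π => ∀ n : ℕ,
          (G.randomTurn r).value (.nature u) * n - K ≤ energy G.weight π n) ∧
      (InitialRatio Bmax Bmin (max (r - ε) 0) → ∃ K : ℝ,
        G.MinEnsures tie v Bmax Bmin fun π => ∀ n : ℕ,
          energy G.weight π n ≤ (G.randomTurn r).value (.nature u) * n + K) := by
  have : Nonempty V := ⟨v⟩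
  obtain ⟨c₀, h, up, down, hp⟩ := hG.exists_isPotential r.2.1 r.2.2
  rw [hp.value_randomTurn u]
  refine ⟨fun c => ⟨fun hc => ?_, fun hc => ?_⟩, fun ε hε Bmax Bmin => ⟨?_, ?_⟩⟩
  · exact le_antisymm (hp.value_le hG r.2.1 r.2.2 hc) (hp.le_value hG r.2.1 r.2.2 hc)
  · exact hc ▸ hp.isValue r.2.1 r.2.2 tie v
  · exact hp.maxEnsures r.2.1 r.2.2 tie v hε
  · exact hp.minEnsures r.2.1 r.2.2 tie v hε
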